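/- **Uniform hyperbolicity.** Let $\mathcal A$ be a finite alphabet with $d\ge 2$ letters. A combinatorial datum $\pi=(\pi_0,\pi_1)$ is a pair of bijections $\mathcal A\to\{1,\dots,d\}$. It is *irreducible* if $\pi_1\circ\pi_0^{-1}(\{1,\dots,s\})\neq\{1,\dots,s\}$ for $1\le s\le d-1$. It has *genus one* if an interval exchange map with datum $\pi$ has at most two discontinuities, that is, if there are at most two letters $\beta$ for which some letter $\alpha$ satisfies $\pi_0(\beta)=\pi_0(\alpha)+1$ and $\pi_1(\beta)\ne\pi_1(\alpha)+1$. For $\varepsilon\in\{0,1\}$ let $\alpha(\varepsilon)$ be the letter with $\pi_\varepsilon(\alpha(\varepsilon))=d$. The Rauzy–Veech step of type $\varepsilon$, with winner $\alpha(\varepsilon)$ and loser $\alpha(1-\varepsilon)$, maps $\pi$ to the datum $r_\varepsilon(\pi)$ which has the same row $\varepsilon$ and in whose row $1-\varepsilon$ the loser has been moved to the position immediately after the winner. Its matrix is $\Theta_{\pi,\varepsilon}=I+E_{\alpha(1-\varepsilon)\,\alpha(\varepsilon)}$, where $E_{\alpha\beta}$ has its only nonzero entry, equal to $1$, in position $(\alpha,\beta)$.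 Let $\Omega_\pi$ be the antisymmetric matrix $$(\Omega_\pi)_{\alpha\beta}=\begin{cases}+1&\pi_1(\alpha)>\pi_1(\beta),\ \pi_0(\alpha)<\pi_0(\beta),\\-1&\pi_1(\alpha)<\pi_1(\beta),\ \pi_0(\alpha)>\pi_0(\beta),\\0&\text{otherwise,}\end{cases}$$ and let $T^+_\pi$ be the set of $\tau\in\mathbb R^{\mathcal A}$ with $\sum_{\pi_0(\alpha)\le j}\tau_\alpha>0$ and $\sum_{\pi_1(\alpha)\le j}\tau_\alpha<0$ for all $1\le j\le d-1$. Put $C^u_\pi=-\Omega_\pi T^+_\pi$ and $C^s_\pi=\Omega_\pi\mathbb R_+^{\mathcal A}$ with $\mathbb R_+=(0,\infty)$. Let $(\pi^n,\varepsilon^n)_{n\ge0}$ be a sequence of irreducible genus-one data and types with $r_{\varepsilon^n}(\pi^n)=\pi^{n+1}$, and let $\alpha^n(\varepsilon)$ denote the letter $\alpha(\varepsilon)$ of $\pi^n$. The sequence is *$k$-bounded* if for all $n\ge 0$ and $\beta,\gamma\in\mathcal A$ there are $n_1,p\ge0$ with $|n-n_1|<k$ and $|n-n_1-p|<k$ such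 that $\alpha^{n_1}(\varepsilon^{n_1})=\beta$, $\alpha^{n_1+p}(1-\varepsilon^{n_1+p})=\gamma$ and $\alpha^{n_1+i}(1-\varepsilon^{n_1+p})=\alpha^{n_1+i+1}(\varepsilon^{n_1+i})$ for all $0\le i<p$. For each $k\in\mathbb N$ there is $\mu=\mu(k)>1$ such that for every such alphabet $\mathcal A$ and every norm $\|\cdot\|$ on $\mathbb R^{\mathcal A}$ there are constants $C_1,C_2>0$, depending only on $k$, $\mathcal A$ and the norm, with the following property. For every $k$-bounded sequence $(\pi^n,\varepsilon^n)$ as above: (a) for every $n\ge0$ and $v\in C^u_{\pi^0}$, $$\|\Theta_{\pi^n,\varepsilon^n}\cdots\Theta_{\pi^1,\varepsilon^1}\Theta_{\pi^0,\varepsilon^0}\,v\|\ \ge\ C_1\,\mu^n\,\|v\|;$$ (b) for every $n\ge0$ and $v\in C^s_{\pi^n}$, $$\|(\Theta_{\pi^{n-1},\varepsilon^{n-1}}\cdots\Theta_{\pi^1,\varepsilon^1}\Theta_{\pi^0,\varepsilon^0})^{-1}v\|\ \ge\ C_2\,\mu^n\,\|v\|.$$ -/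

import Mathlib

/-- Combinatorial data `π = (π₀, π₁)` on the alphabet `A` with `d` letters: two bijections
`A → {1, …, d}`. -/
structure CombData (A : Type*) [Fintype A] where
  pos : Fin 2 → A → ℕ
  bij : ∀ e, Set.BijOn (pos e) Set.univ (Set.Icc 1 (Fintype.card A))

namespace CombData

variable {A : Type*} [Fintype A]

/-- `π₁ ∘ π₀⁻¹ {1, …, s} ≠ {1, …, s}` for all `1 ≤ s ≤ d - 1`. -/
def IsIrreducible (π : CombData A) : Prop :=
  ∀ s : ℕ, 1 ≤ s → s < Fintype.card A →
    π.pos 1 '' (π.pos 0 ⁻¹' Set.Icc 1 s) ≠ Set.Icc 1 s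

/-- The letters `β` such that a map `f` with data `π` is discontinuous at the left endpoint of
`I_β`: `β` follows a letter `α` in the domain, but the image of `I_β` does not follow that of
`I_α`. -/
def discontinuities (π : CombData A) : Set A :=
  {β | ∃ α, π.pos 0 β = π.pos 0 α + 1 ∧ π.pos 1 β ≠ π.pos 1 α + 1}

/-- At most two discontinuities. -/
def IsGenusOne (π : CombData A) : Prop := π.discontinuities.ncard ≤ 2

theorem exists_last [Nonempty A] (π : CombData A) (e : Fin 2) :
    ∃ a, π.pos e a = Fintype.card A := by
  obtain ⟨a, -, ha⟩ := (π.bij e).surjOn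
    (Set.mem_Icc.2 ⟨Fintype.card_pos (α := A), le_refl (Fintype.card A)⟩)
  exact ⟨a, ha⟩

/-- The letter `α(e)`, with `π_e(α(e)) = d`. -/
noncomputable def lastLetter [Nonempty A] (π : CombData A) (e : Fin 2) : A :=
  (π.exists_last e).choose

theorem pos_lastLetter [Nonempty A] (π : CombData A) (e : Fin 2) :
    π.pos e (π.lastLetter e) = Fintype.card A := (π.exists_last e).choose_spec

/-- Positions after one Rauzy-Veech step of type `e` (winner `α(e)`, loser `α(1-e)`): row `e` is
unchanged, and in row `1 - e` the loser is moved to the place right after the winner. -/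
noncomputable def rauzyPos [Nonempty A] (π : CombData A) (e i : Fin 2) (a : A) : ℕ :=
  if i = e then π.pos i a
  else if π.pos i a ≤ π.pos i (π.lastLetter e) then π.pos i a
  else if π.pos i a < Fintype.card A then π.pos i a + 1
  else π.pos i (π.lastLetter e) + 1

theorem rauzyPos_bij [Nonempty A] (π : CombData A) (e i : Fin 2) :
    Set.BijOn (π.rauzyPos e i) Set.univ (Set.Icc 1 (Fintype.card A)) := by
  have hmem : ∀ a, 1 ≤ π.pos i a ∧ π.pos i a ≤ Fintype.card A := fun a =>
    Set.mem_Icc.1 ((π.bij i).mapsTo (Set.mem_univ a))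
  have hmaps : Set.MapsTo (π.rauzyPos e i) Set.univ (Set.Icc 1 (Fintype.card A)) := by
    intro a _
    have h1 := hmem a
    have h2 := hmem (π.lastLetter e)
    rw [Set.mem_Icc]
    unfold rauzyPos
    split_ifs <;> omega
  have hinj : Set.InjOn (π.rauzyPos e i) Set.univ := by
    intro a _ b _ hab
    have h1 := hmem a
    have h2 := hmem b
    apply (π.bij i).injOn (Set.mem_univ a) (Set.mem_univ b)
    unfold rauzyPos at hab
    split_ifs at hab <;> omega
  have himg : π.rauzyPos e i '' Set.univ = Set.Icc 1 (Fintype.card A) := by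
    apply Set.eq_of_subset_of_ncard_le hmaps.image_subset _ (Set.finite_Icc _ _)
    rw [hinj.ncard_image, Set.ncard_univ, Nat.card_eq_fintype_card, ← Finset.coe_Icc,
      Set.ncard_coe_finset, Nat.card_Icc]
    omega
  exact ⟨hmaps, hinj, himg.ge⟩

/-- The combinatorial data `r_e(π)`. -/
noncomputable def rauzy [Nonempty A] (e : Fin 2) (π : CombData A) : CombData A where
  pos := π.rauzyPos e
  bij := π.rauzyPos_bij e

/-- The antisymmetric matrix `Ω_π`. -/
def Omega (π : CombData A) : Matrix A A ℝ := Matrix.of fun a b =>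
  if π.pos 1 a > π.pos 1 b ∧ π.pos 0 a < π.pos 0 b then 1
  else if π.pos 1 a < π.pos 1 b ∧ π.pos 0 a > π.pos 0 b then -1
  else 0

/-- The Rauzy-Veech matrix `Θ_{π,e} = I + E_{α(1-e) α(e)}`. -/
noncomputable def Theta [DecidableEq A] [Nonempty A] (π : CombData A) (e : Fin 2) :
    Matrix A A ℝ :=
  1 + Matrix.single (π.lastLetter (1 - e)) (π.lastLetter e) 1

/-- The cone `T⁺_π`. -/
def TPlus (π : CombData A) : Set (A → ℝ) :=
  {τ | ∀ k : ℕ, 1 ≤ k → k < Fintype.card A →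
    0 < (∑ a with π.pos 0 a ≤ k, τ a) ∧ (∑ a with π.pos 1 a ≤ k, τ a) < 0}

/-- The cone `C^u_π = -Ω_π T⁺_π`. -/
def coneU (π : CombData A) : Set (A → ℝ) := (fun τ => -(π.Omega.mulVec τ)) '' π.TPlus

/-- The cone `C^s_π = Ω_π ℝ₊^A`, where `ℝ₊ = (0, ∞)`. -/
def coneS (π : CombData A) : Set (A → ℝ) :=
  (fun w => π.Omega.mulVec w) '' {w | ∀ a, 0 < w a}

/-- A sequence of genus-one irreducible data and types, linked by Rauzy-Veech induction. -/
structure IsGenusOneCombinatorics [Nonempty A] (π : ℕ → CombData A) (ε : ℕ → Fin 2) :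
    Prop where
  irreducible : ∀ n, (π n).IsIrreducible
  genusOne : ∀ n, (π n).IsGenusOne
  step : ∀ n, (π n).rauzy (ε n) = π (n + 1)

/-- `k`-bounded combinatorics; `(π m).lastLetter (ε m)` and `(π m).lastLetter (1 - ε m)` are the
winner and the loser of the `m`-th step. -/
def IsBounded [Nonempty A] (k : ℕ) (π : ℕ → CombData A) (ε : ℕ → Fin 2) : Prop :=
  ∀ (n : ℕ) (β γ : A), ∃ n₁ p : ℕ,
    |(n : ℤ) - n₁| < k ∧ |(n : ℤ) - n₁ - p| < k ∧
    (π n₁).lastLetter (ε n₁) = β ∧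
    (π (n₁ + p)).lastLetter (1 - ε (n₁ + p)) = γ ∧
    ∀ i < p, (π (n₁ + i)).lastLetter (1 - ε (n₁ + p)) =
      (π (n₁ + i + 1)).lastLetter (ε (n₁ + i))

/-- The product `Θ_{π^{n-1},ε^{n-1}} ⋯ Θ_{π^1,ε^1} Θ_{π^0,ε^0}` of the first `n` matrices. -/
noncomputable def cocycle [DecidableEq A] [Nonempty A] (π : ℕ → CombData A) (ε : ℕ → Fin 2) :
    ℕ → Matrix A A ℝ
  | 0 => 1
  | n + 1 => (π n).Theta (ε n) * cocycle π ε n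

end CombData

namespace CombData

variable {A : Type*} [Fintype A]

theorem pos_mem (π : CombData A) (e : Fin 2) (a : A) :
    1 ≤ π.pos e a ∧ π.pos e a ≤ Fintype.card A :=
  Set.mem_Icc.1 ((π.bij e).mapsTo (Set.mem_univ a))

theorem pos_injective (π : CombData A) (e : Fin 2) : Function.Injective (π.pos e) :=
  fun _ _ h => (π.bij e).injOn (Set.mem_univ _) (Set.mem_univ _) h

theorem exists_pos_eq (π : CombData A) (e : Fin 2) {s : ℕ} (h1 : 1 ≤ s)
    (h2 : s ≤ Fintype.card A) : ∃ a, π.pos e a = s := by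
  obtain ⟨a, -, ha⟩ := (π.bij e).surjOn (Set.mem_Icc.2 ⟨h1, h2⟩)
  exact ⟨a, ha⟩

theorem eq_lastLetter [Nonempty A] (π : CombData A) {e : Fin 2} {a : A}
    (h : π.pos e a = Fintype.card A) : π.lastLetter e = a :=
  π.pos_injective e (by rw [π.pos_lastLetter, h])

theorem IsIrreducible.exists_pos_one_lt [Nontrivial A] {π : CombData A} (h : π.IsIrreducible) :
    ∃ a b, π.pos 0 a = 1 ∧ π.pos 1 b = 1 ∧ a ≠ b := by
  have hc := Fintype.one_lt_card (α := A)
  obtain ⟨a, ha⟩ := π.exists_pos_eq 0 le_rfl hc.le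
  obtain ⟨b, hb⟩ := π.exists_pos_eq 1 le_rfl hc.le
  refine ⟨a, b, ha, hb, ?_⟩
  rintro rfl
  apply h 1 le_rfl hc
  have : π.pos 0 ⁻¹' Set.Icc 1 1 = {a} := by
    ext c
    simp only [Set.Icc_self, Set.mem_preimage, Set.mem_singleton_iff]
    exact ⟨fun hc => π.pos_injective 0 (hc.trans ha.symm), fun hc => hc ▸ ha⟩
  rw [this, Set.image_singleton, hb, Set.Icc_self]

theorem IsIrreducible.lastLetter_ne [Nontrivial A] {π : CombData A} (h : π.IsIrreducible) :
    π.lastLetter 0 ≠ π.lastLetter 1 := by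
  intro heq
  have hc := Fintype.one_lt_card (α := A)
  have h0 := π.pos_lastLetter 0
  have h1 := π.pos_lastLetter 1
  rw [← heq] at h1
  apply h (Fintype.card A - 1) (by omega) (by omega)
  have key : ∀ e a, π.pos e (π.lastLetter 0) = Fintype.card A →
      (π.pos e a ∈ Set.Icc 1 (Fintype.card A - 1) ↔ a ≠ π.lastLetter 0) := by
    intro e a he
    have hm := π.pos_mem e a
    rw [← (π.pos_injective e).ne_iff, he, Set.mem_Icc]
    omega
  ext s
  constructor
  · rintro ⟨a, ha, rfl⟩
    exact (key 1 a h1).2 ((key 0 a h0).1 ha)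
  · intro hs
    obtain ⟨a, rfl⟩ := π.exists_pos_eq 1 hs.1 (hs.2.trans (Nat.sub_le _ _))
    exact ⟨a, (key 0 a h0).2 ((key 1 a h1).1 hs), rfl⟩

theorem IsIrreducible.lastLetter_injective [Nontrivial A] {π : CombData A}
    (h : π.IsIrreducible) : Function.Injective π.lastLetter := by
  have h1 := h.lastLetter_ne
  intro i j hij
  fin_cases i <;> fin_cases j <;> simp_all

theorem IsIrreducible.loser_ne_winner [Nontrivial A] {π : CombData A} (h : π.IsIrreducible)
    (e : Fin 2) : π.lastLetter (1 - e) ≠ π.lastLetter e :=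
  h.lastLetter_injective.ne (by fin_cases e <;> decide)

theorem lastLetter_rauzy_self [Nonempty A] (π : CombData A) (e : Fin 2) :
    (π.rauzy e).lastLetter e = π.lastLetter e :=
  eq_lastLetter _ (by simp [rauzy, rauzyPos, pos_lastLetter])

/-- In a bounded sequence each letter directly beats every other letter within the window: a
chain of positive length in `IsBounded` forces its two ends to coincide. -/
theorem IsBounded.exists_winner_loser [Nontrivial A] {k : ℕ} {π : ℕ → CombData A}
    {ε : ℕ → Fin 2} (hb : IsBounded k π ε) (hirr : ∀ n, (π n).IsIrreducible)
    (hstep : ∀ n, (π n).rauzy (ε n) = π (n + 1)) (n : ℕ) {β γ : A} (hne : β ≠ γ) :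
    ∃ m : ℕ, |(n : ℤ) - m| < k ∧ (π m).lastLetter (ε m) = β ∧
      (π m).lastLetter (1 - ε m) = γ := by
  obtain ⟨m, p, hm, -, hβ, hγ, hchain⟩ := hb n β γ
  rcases Nat.eq_zero_or_pos p with rfl | hp
  · exact ⟨m, hm, hβ, hγ⟩
  have hsame : ∀ i, (π (i + 1)).lastLetter (ε i) = (π i).lastLetter (ε i) := fun i => by
    rw [← hstep, lastLetter_rauzy_self]
  have hrun : ∀ i ≤ p, (π (m + i)).lastLetter (1 - ε (m + p)) = β := by
    intro i
    induction i with
    | zero =>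
      intro _
      have := hchain 0 hp
      rwa [hsame (m + 0), add_zero, hβ] at this
    | succ i ih =>
      intro hi
      have h1 := hchain i hi
      rw [hsame] at h1
      have h2 := (hirr _).lastLetter_injective h1
      rw [← add_assoc, h2, hsame, ← h2]
      exact ih (by omega)
  exact absurd ((hrun p le_rfl).symm.trans hγ) hne

theorem rauzyPos_self [Nonempty A] (π : CombData A) (e : Fin 2) (a : A) :
    π.rauzyPos e e a = π.pos e a := if_pos rfl

section Matrices

variable [DecidableEq A]

theorem Theta_apply [Nonempty A] (π : CombData A) (e : Fin 2) (a b : A) :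
    π.Theta e a b = (1 : Matrix A A ℝ) a b +
      if π.lastLetter (1 - e) = a ∧ π.lastLetter e = b then 1 else 0 := by
  simp [Theta, Matrix.single_apply]

theorem one_apply_le_Theta [Nonempty A] (π : CombData A) (e : Fin 2) (a b : A) :
    (1 : Matrix A A ℝ) a b ≤ π.Theta e a b := by
  rw [Theta_apply]
  split_ifs <;> simp

theorem Theta_mulVec_apply [Nonempty A] (π : CombData A) (e : Fin 2) (v : A → ℝ) (a : A) :
    (π.Theta e).mulVec v a =
      v a + if a = π.lastLetter (1 - e) then v (π.lastLetter e) else 0 := by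
  simp [Theta, Matrix.add_mulVec, Matrix.single_mulVec, Function.update_apply]

theorem norm_Theta_mulVec_le [Nonempty A] (π : CombData A) (e : Fin 2) (v : A → ℝ) :
    ‖(π.Theta e).mulVec v‖ ≤ 2 * ‖v‖ := by
  refine (pi_norm_le_iff_of_nonneg (by positivity)).2 fun a => ?_
  rw [Theta_mulVec_apply]
  refine (norm_add_le _ _).trans ?_
  have h1 := norm_le_pi_norm v a
  have h2 := norm_le_pi_norm v (π.lastLetter e)
  have h3 := norm_nonneg v
  split_ifs
  · linarith
  · rw [norm_zero]; linarith

theorem isUnit_Theta [Nontrivial A] {π : CombData A} (h : π.IsIrreducible) (e : Fin 2) :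
    IsUnit (π.Theta e) := by
  refine IsUnit.of_mul_eq_one
    (1 - Matrix.single (π.lastLetter (1 - e)) (π.lastLetter e) 1) ?_
  have : Matrix.single (π.lastLetter (1 - e)) (π.lastLetter e) (1 : ℝ) *
      Matrix.single (π.lastLetter (1 - e)) (π.lastLetter e) 1 = 0 :=
    Matrix.single_mul_single_of_ne _ _ _ _ (h.loser_ne_winner e).symm _
  rw [Theta, mul_sub, add_mul, add_mul, this]
  simp

/-- `Θ_{π,e} Ω_π Θ_{π,e}ᵀ = Ω_{r_e(π)}`. -/
theorem Theta_mul_Omega_mul_transpose [Nontrivial A] {π : CombData A} (h : π.IsIrreducible)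
    (e : Fin 2) : π.Theta e * π.Omega * (π.Theta e).transpose = (π.rauzy e).Omega := by
  have hlw := h.loser_ne_winner e
  have hw := π.pos_lastLetter e
  have hl := π.pos_lastLetter (1 - e)
  have hinj : ∀ i a b, π.pos i a = π.pos i b ↔ a = b := fun i a b =>
    (π.pos_injective i).eq_iff
  have hmem := π.pos_mem
  have hentry : ∀ a b, (π.Theta e * π.Omega * (π.Theta e).transpose) a b =
      π.Omega a b + (if a = π.lastLetter (1 - e) then π.Omega (π.lastLetter e) b else 0) +
      (if b = π.lastLetter (1 - e) then (π.Omega a (π.lastLetter e) +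
        if a = π.lastLetter (1 - e) then π.Omega (π.lastLetter e) (π.lastLetter e) else 0)
        else 0) := by
    intro a b
    have h1 : ∀ M : Matrix A A ℝ, ∀ c d, (π.Theta e * M) c d =
        M c d + if c = π.lastLetter (1 - e) then M (π.lastLetter e) d else 0 := fun M c d =>
      π.Theta_mulVec_apply e (fun x => M x d) c
    rw [← Matrix.transpose_apply (π.Theta e * π.Omega * (π.Theta e).transpose), Matrix.transpose_mul, Matrix.transpose_transpose, h1,
      Matrix.transpose_apply, Matrix.transpose_apply, h1, h1]
  have hrow : ∀ i a, (π.rauzy e).pos i a = π.rauzyPos e i a := fun _ _ => rfl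
  have he : 1 - e ≠ e := by fin_cases e <;> decide
  have hlt : ∀ a, a ≠ π.lastLetter (1 - e) → π.pos (1 - e) a < Fintype.card A := fun a ha =>
    lt_of_le_of_ne (hmem _ a).2 fun h' => ha ((hinj _ _ _).1 (h'.trans hl.symm))
  have hwlt : ∀ a, a ≠ π.lastLetter e → π.pos e a < Fintype.card A := fun a ha =>
    lt_of_le_of_ne (hmem _ a).2 fun h' => ha ((hinj _ _ _).1 (h'.trans hw.symm))
  have hww := hlt _ hlw.symm
  have hll := hwlt _ hlw
  have r1 : ∀ a b, a ≠ π.lastLetter (1 - e) → b ≠ π.lastLetter (1 - e) →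
      (π.rauzyPos e (1 - e) a < π.rauzyPos e (1 - e) b ↔
        π.pos (1 - e) a < π.pos (1 - e) b) := by
    intro a b ha hb
    have := hlt a ha
    have := hlt b hb
    simp only [rauzyPos, if_neg he]
    split_ifs <;> omega
  have r2 : ∀ b, b ≠ π.lastLetter (1 - e) →
      (π.rauzyPos e (1 - e) (π.lastLetter (1 - e)) < π.rauzyPos e (1 - e) b ↔
        π.pos (1 - e) (π.lastLetter e) < π.pos (1 - e) b) := by
    intro b hb
    have := hlt b hb
    simp only [rauzyPos, if_neg he]
    split_ifs <;> omega
  have r3 : ∀ a, a ≠ π.lastLetter (1 - e) →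
      (π.rauzyPos e (1 - e) a < π.rauzyPos e (1 - e) (π.lastLetter (1 - e)) ↔
        π.pos (1 - e) a ≤ π.pos (1 - e) (π.lastLetter e)) := by
    intro a ha
    have := hlt a ha
    simp only [rauzyPos, if_neg he]
    split_ifs <;> omega
  ext a b
  rw [hentry]
  simp only [Omega, Matrix.of_apply, hrow, gt_iff_lt]
  generalize hL : π.lastLetter (1 - e) = l at *
  generalize hW : π.lastLetter e = w at *
  have hra := π.rauzyPos_self e
  have hcase : ∀ c, c ≠ l → c = w ∨ (c ≠ l ∧ π.pos (1 - e) c < Fintype.card A ∧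
      π.pos e c < Fintype.card A ∧ π.pos (1 - e) c ≠ π.pos (1 - e) w ∧
      π.pos e c ≠ π.pos e l) := fun c hcl => or_iff_not_imp_left.2 fun hc =>
    ⟨hcl, hlt c hcl, hwlt c hc, mt (hinj _ _ _).1 hc, mt (hinj _ _ _).1 hcl⟩
  have hA : a = l ∨ a = w ∨ _ := or_iff_not_imp_left.2 (hcase a)
  have hB : b = l ∨ b = w ∨ _ := or_iff_not_imp_left.2 (hcase b)
  have hwl := hlw.symm
  clear hentry hrow hL hW hlt hwlt hinj hmem h hcase
  rcases hA with rfl | rfl | ⟨ha, a1, a2, a3, a4⟩ <;> rcases hB with rfl | rfl | ⟨hb, b1, b2, b3, b4⟩ <;>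
    fin_cases e <;> simp only [Fin.zero_eta, Fin.mk_one, sub_zero, sub_self, Fin.isValue] at * <;>
    simp only [*, if_true, if_false, lt_self_iff_false, ne_eq,
      not_false_eq_true, and_self, true_and, and_true, false_and, and_false, add_zero] <;>
    split_ifs <;> first | (norm_num; done) | (exfalso; omega)

end Matrices

theorem coneU_nonneg [Nontrivial A] {π : CombData A} {v : A → ℝ} (hv : v ∈ π.coneU) :
    ∀ a, 0 ≤ v a := by
  obtain ⟨τ, hτ, rfl⟩ := hv
  intro a
  have hsum : ∀ e, ∃ P : ℝ, (P = ∑ b with π.pos e b ≤ π.pos e a - 1, τ b) ∧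
      P = ∑ b, if π.pos e b < π.pos e a then τ b else 0 := fun e => by
    refine ⟨_, rfl, ?_⟩
    rw [Finset.sum_filter]
    refine Finset.sum_congr rfl fun b _ => if_congr ?_ rfl rfl
    have := π.pos_mem e a
    omega
  obtain ⟨P, hP, hP'⟩ := hsum 0
  obtain ⟨R, hR, hR'⟩ := hsum 1
  have hzero : ∀ e, π.pos e a = 1 → ∑ b with π.pos e b ≤ π.pos e a - 1, τ b = 0 := by
    intro e he
    refine Finset.sum_eq_zero fun b hb => ?_
    have := (Finset.mem_filter.1 hb).2
    have := π.pos_mem e b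
    omega
  have hP0 : 0 ≤ P := by
    rcases (π.pos_mem 0 a).1.eq_or_lt with h | h
    · rw [hP, hzero 0 h.symm]
    · rw [hP]
      exact (hτ _ (by omega) (by have := π.pos_mem 0 a; omega)).1.le
  have hR0 : R ≤ 0 := by
    rcases (π.pos_mem 1 a).1.eq_or_lt with h | h
    · rw [hR, hzero 1 h.symm]
    · rw [hR]
      exact (hτ _ (by omega) (by have := π.pos_mem 1 a; omega)).2.le
  have hval : (-(π.Omega.mulVec τ)) a = P - R := by
    rw [hP', hR', ← Finset.sum_sub_distrib, Pi.neg_apply, Matrix.mulVec, dotProduct,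
      ← Finset.sum_neg_distrib]
    refine Finset.sum_congr rfl fun b _ => ?_
    have h0 := (π.pos_injective 0).eq_iff (a := a) (b := b)
    have h1 := (π.pos_injective 1).eq_iff (a := a) (b := b)
    rcases eq_or_ne a b with rfl | hab
    · simp [Omega]
    · replace h0 := mt h0.1 hab
      replace h1 := mt h1.1 hab
      simp only [Omega, Matrix.of_apply]
      split_ifs <;> first | (exfalso; omega) | ring
  simp only [hval]
  linarith

theorem abs_Omega_apply_le (π : CombData A) (a b : A) : |π.Omega a b| ≤ 1 := by
  simp only [Omega, Matrix.of_apply]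
  split_ifs <;> simp

theorem norm_Omega_mulVec_le (π : CombData A) {w : A → ℝ} (hw : ∀ a, 0 ≤ w a) :
    ‖π.Omega.mulVec w‖ ≤ ∑ a, w a := by
  refine (pi_norm_le_iff_of_nonneg (Finset.sum_nonneg fun a _ => hw a)).2 fun a => ?_
  refine (norm_sum_le _ _).trans (Finset.sum_le_sum fun b _ => ?_)
  rw [norm_mul, Real.norm_of_nonneg (hw b)]
  exact mul_le_of_le_one_left (hw b) (π.abs_Omega_apply_le a b)

/-- The coordinate of `Ω_π u` at the first letter of the top row is the sum of the `u_b` over the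
letters `b` preceding it in the bottom row. -/
theorem IsIrreducible.exists_le_norm_Omega_mulVec [Nontrivial A] {π : CombData A}
    (h : π.IsIrreducible) : ∃ b, ∀ u : A → ℝ, (∀ a, 0 ≤ u a) →
      u b ≤ ‖π.Omega.mulVec u‖ := by
  obtain ⟨a, b, ha, hb, hab⟩ := h.exists_pos_one_lt
  refine ⟨b, fun u hu => ?_⟩
  have hnn : ∀ c, 0 ≤ π.Omega a c := by
    intro c
    have := π.pos_mem 0 c
    simp only [Omega, Matrix.of_apply]
    split_ifs
    · exact zero_le_one
    · omega
    · exact le_rfl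
  have hone : π.Omega a b = 1 := by
    have h0 := (π.pos_injective 0).ne hab
    have h1 := (π.pos_injective 1).ne hab
    have := π.pos_mem 0 b
    have := π.pos_mem 1 a
    simp only [Omega, Matrix.of_apply]
    rw [if_pos]
    omega
  calc u b = π.Omega a b * u b := by rw [hone, one_mul]
    _ ≤ π.Omega.mulVec u a :=
      Finset.single_le_sum (f := fun c => π.Omega a c * u c)
        (fun c _ => mul_nonneg (hnn c) (hu c)) (Finset.mem_univ b)
    _ ≤ ‖π.Omega.mulVec u a‖ := le_abs_self _
    _ ≤ _ := norm_le_pi_norm _ a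

section Cocycle

variable [DecidableEq A]

theorem cocycle_succ [Nonempty A] (π : ℕ → CombData A) (ε : ℕ → Fin 2) (n : ℕ) :
    cocycle π ε (n + 1) = (π n).Theta (ε n) * cocycle π ε n := rfl

theorem cocycle_add [Nonempty A] (π : ℕ → CombData A) (ε : ℕ → Fin 2) (m n : ℕ) :
    cocycle π ε (m + n) =
      cocycle (fun i => π (m + i)) (fun i => ε (m + i)) n * cocycle π ε m := by
  induction n with
  | zero => simp [cocycle]
  | succ n ih => rw [← add_assoc, cocycle_succ, ih, cocycle_succ, mul_assoc]

theorem one_apply_nonneg {A : Type*} [DecidableEq A] (a b : A) : (0 : ℝ) ≤ (1 : Matrix A A ℝ) a b := by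
  rw [Matrix.one_apply]
  split_ifs <;> simp

theorem le_mul_apply_of_one_le_left {X Y : Matrix A A ℝ}
    (hX : ∀ a b, (1 : Matrix A A ℝ) a b ≤ X a b) (hY : ∀ a b, 0 ≤ Y a b) (a b : A) :
    Y a b ≤ (X * Y) a b := by
  have : Y a b = ((1 : Matrix A A ℝ) * Y) a b := by rw [one_mul]
  rw [this, Matrix.mul_apply, Matrix.mul_apply]
  exact Finset.sum_le_sum fun c _ => mul_le_mul_of_nonneg_right (hX a c) (hY c b)

theorem le_mul_apply_of_one_le_right {X Y : Matrix A A ℝ} (hX : ∀ a b, 0 ≤ X a b)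
    (hY : ∀ a b, (1 : Matrix A A ℝ) a b ≤ Y a b) (a b : A) :
    X a b ≤ (X * Y) a b := by
  have : X a b = (X * (1 : Matrix A A ℝ)) a b := by rw [mul_one]
  rw [this, Matrix.mul_apply, Matrix.mul_apply]
  exact Finset.sum_le_sum fun c _ => mul_le_mul_of_nonneg_left (hY c b) (hX a c)

theorem Theta_nonneg [Nonempty A] (π : CombData A) (e : Fin 2) (a b : A) : 0 ≤ π.Theta e a b :=
  (one_apply_nonneg a b).trans (π.one_apply_le_Theta e a b)

theorem one_apply_le_cocycle [Nonempty A] (π : ℕ → CombData A) (ε : ℕ → Fin 2) (n : ℕ) :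
    ∀ a b, (1 : Matrix A A ℝ) a b ≤ cocycle π ε n a b := by
  induction n with
  | zero => exact fun _ _ => le_rfl
  | succ n ih =>
    exact fun a b => (ih a b).trans (le_mul_apply_of_one_le_left ((π n).one_apply_le_Theta _)
      (fun a b => (one_apply_nonneg a b).trans (ih a b)) a b)

theorem cocycle_nonneg [Nonempty A] (π : ℕ → CombData A) (ε : ℕ → Fin 2) (n : ℕ) (a b : A) :
    0 ≤ cocycle π ε n a b :=
  (one_apply_nonneg a b).trans (one_apply_le_cocycle π ε n a b)

theorem Theta_apply_le_cocycle [Nonempty A] (π : ℕ → CombData A) (ε : ℕ → Fin 2) {m n : ℕ}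
    (h : m < n) (a b : A) : (π m).Theta (ε m) a b ≤ cocycle π ε n a b := by
  induction n, h using Nat.le_induction with
  | base =>
    exact le_mul_apply_of_one_le_right (Theta_nonneg _ _) (one_apply_le_cocycle π ε m) a b
  | succ n _ ih =>
    exact ih.trans (le_mul_apply_of_one_le_left ((π n).one_apply_le_Theta _)
      (cocycle_nonneg π ε n) a b)

/-- Over any window of `2k + 1` steps of a `k`-bounded sequence the cocycle has entries `≥ 1`. -/
theorem IsBounded.one_le_cocycle_window [Nontrivial A] {k : ℕ} {π : ℕ → CombData A}
    {ε : ℕ → Fin 2} (hb : IsBounded k π ε) (hirr : ∀ n, (π n).IsIrreducible)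
    (hstep : ∀ n, (π n).rauzy (ε n) = π (n + 1)) (m : ℕ) (a b : A) :
    1 ≤ cocycle (fun i => π (m + i)) (fun i => ε (m + i)) (2 * k + 1) a b := by
  rcases eq_or_ne b a with rfl | hne
  · have := one_apply_le_cocycle (fun i => π (m + i)) (fun i => ε (m + i)) (2 * k + 1) b b
    rwa [Matrix.one_apply_eq] at this
  · obtain ⟨j, hj, hw, hl⟩ := hb.exists_winner_loser hirr hstep (m + k) hne
    rw [abs_lt] at hj
    obtain ⟨i, rfl⟩ : ∃ i, j = m + i := ⟨j - m, by push_cast at hj; omega⟩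
    refine le_trans ?_ (Theta_apply_le_cocycle (fun i => π (m + i)) (fun i => ε (m + i))
      (m := i) (by push_cast at hj; omega) a b)
    rw [Theta_apply, if_pos ⟨hl, hw⟩]
    linarith [one_apply_nonneg a b]

theorem two_pow_le_cocycle [Nontrivial A] {L : ℕ} (hL : 0 < L) {π : ℕ → CombData A}
    {ε : ℕ → Fin 2}
    (h : ∀ m a b, 1 ≤ cocycle (fun i => π (m + i)) (fun i => ε (m + i)) L a b) {n : ℕ}
    (hn : L ≤ n) (a b : A) : (2 : ℝ) ^ (n / L - 1) ≤ cocycle π ε n a b := by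
  have hblock : ∀ q a b, (2 : ℝ) ^ q ≤ cocycle π ε (L * (q + 1)) a b := by
    intro q
    induction q with
    | zero => simpa using h 0
    | succ q ih =>
      intro a b
      rw [mul_add, mul_one, cocycle_add, Matrix.mul_apply]
      calc (2 : ℝ) ^ (q + 1) = 2 * 2 ^ q := pow_succ' _ _
        _ ≤ Fintype.card A * 2 ^ q := by
          have : 2 ≤ Fintype.card A := Fintype.one_lt_card
          gcongr
          exact_mod_cast this
        _ = ∑ _c : A, (1 : ℝ) * 2 ^ q := by simp
        _ ≤ _ := Finset.sum_le_sum fun c _ =>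
          mul_le_mul (h _ a c) (ih c b) (by positivity) (zero_le_one.trans (h _ a c))
  have hq : 1 ≤ n / L := (Nat.one_le_div_iff hL).2 hn
  have hdecomp : n = L * (n / L - 1 + 1) + n % L := by
    rw [Nat.sub_add_cancel hq, Nat.div_add_mod]
  refine (hblock (n / L - 1) a b).trans ?_
  conv_rhs => rw [hdecomp, cocycle_add]
  exact le_mul_apply_of_one_le_left (one_apply_le_cocycle _ _ _) (cocycle_nonneg π ε _) a b

theorem norm_cocycle_mulVec_le [Nonempty A] (π : ℕ → CombData A) (ε : ℕ → Fin 2) (n : ℕ)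
    (v : A → ℝ) : ‖(cocycle π ε n).mulVec v‖ ≤ 2 ^ n * ‖v‖ := by
  induction n with
  | zero => simp [cocycle]
  | succ n ih =>
    rw [cocycle_succ, ← Matrix.mulVec_mulVec]
    refine (norm_Theta_mulVec_le _ _ _).trans ?_
    rw [pow_succ']
    linarith

theorem isUnit_cocycle [Nontrivial A] {π : ℕ → CombData A} (hirr : ∀ n, (π n).IsIrreducible)
    (ε : ℕ → Fin 2) (n : ℕ) : IsUnit (cocycle π ε n) := by
  induction n with
  | zero => exact isUnit_one
  | succ n ih => exact (isUnit_Theta (hirr n) _).mul ih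

theorem cocycle_mul_Omega_mul_transpose [Nontrivial A] {π : ℕ → CombData A} {ε : ℕ → Fin 2}
    (hirr : ∀ n, (π n).IsIrreducible) (hstep : ∀ n, (π n).rauzy (ε n) = π (n + 1)) (n : ℕ) :
    cocycle π ε n * (π 0).Omega * (cocycle π ε n).transpose = (π n).Omega := by
  induction n with
  | zero => simp [cocycle]
  | succ n ih =>
    rw [← hstep, ← Theta_mul_Omega_mul_transpose (hirr n), ← ih, cocycle_succ,
      Matrix.transpose_mul]
    simp only [mul_assoc]

theorem cocycle_inv_mulVec_Omega [Nontrivial A] {π : ℕ → CombData A} {ε : ℕ → Fin 2}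
    (hirr : ∀ n, (π n).IsIrreducible) (hstep : ∀ n, (π n).rauzy (ε n) = π (n + 1)) (n : ℕ)
    (w : A → ℝ) : (cocycle π ε n)⁻¹.mulVec ((π n).Omega.mulVec w) =
      (π 0).Omega.mulVec ((cocycle π ε n).transpose.mulVec w) := by
  have hu := (Matrix.isUnit_iff_isUnit_det _).1 (isUnit_cocycle hirr ε n)
  rw [← cocycle_mul_Omega_mul_transpose hirr hstep n, Matrix.mulVec_mulVec,
    Matrix.mulVec_mulVec, mul_assoc, ← mul_assoc, Matrix.nonsing_inv_mul _ hu, one_mul]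

/-- Expansion of the cocycle on nonnegative vectors, in the sup norm. -/
theorem norm_le_norm_cocycle_mulVec [Nontrivial A] {L : ℕ} (hL : 0 < L) {π : ℕ → CombData A}
    {ε : ℕ → Fin 2}
    (h : ∀ m a b, 1 ≤ cocycle (fun i => π (m + i)) (fun i => ε (m + i)) L a b) (n : ℕ)
    {v : A → ℝ} (hv : ∀ a, 0 ≤ v a) :
    2 ^ (n / L - 1) * ‖v‖ ≤ ‖(cocycle π ε n).mulVec v‖ := by
  have hcoord : ∀ a, 2 ^ (n / L - 1) * v a ≤ (cocycle π ε n).mulVec v a := by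
    intro a
    have hle : (2 : ℝ) ^ (n / L - 1) ≤ cocycle π ε n a a := by
      rcases lt_or_ge n L with hn | hn
      · have := one_apply_le_cocycle π ε n a a
        rw [Matrix.one_apply_eq] at this
        rwa [Nat.div_eq_of_lt hn, Nat.zero_sub, pow_zero]
      · exact two_pow_le_cocycle hL h hn a a
    exact (mul_le_mul_of_nonneg_right hle (hv a)).trans
      (Finset.single_le_sum (f := fun c => cocycle π ε n a c * v c)
        (fun c _ => mul_nonneg (cocycle_nonneg _ _ _ _ _) (hv c)) (Finset.mem_univ a))
  rw [← le_div_iff₀' (by positivity)]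
  refine (pi_norm_le_iff_of_nonneg (by positivity)).2 fun a => ?_
  rw [le_div_iff₀' (by positivity), Real.norm_of_nonneg (hv a)]
  exact (hcoord a).trans ((Real.le_norm_self _).trans (norm_le_pi_norm ((cocycle π ε n).mulVec v) a))

/-- Expansion of the inverse cocycle on the cone `C^s`, in the sup norm. -/
theorem norm_le_norm_cocycle_inv_mulVec [Nontrivial A] {L : ℕ} (hL : 0 < L)
    {π : ℕ → CombData A} {ε : ℕ → Fin 2} (hirr : ∀ n, (π n).IsIrreducible)
    (hstep : ∀ n, (π n).rauzy (ε n) = π (n + 1))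
    (h : ∀ m a b, 1 ≤ cocycle (fun i => π (m + i)) (fun i => ε (m + i)) L a b) (n : ℕ)
    {v : A → ℝ} (hv : v ∈ (π n).coneS) :
    2 ^ (n / L - 1) * ‖v‖ ≤ 2 ^ L * ‖(cocycle π ε n)⁻¹.mulVec v‖ := by
  rcases lt_or_ge n L with hn | hn
  · have hu := (Matrix.isUnit_iff_isUnit_det _).1 (isUnit_cocycle hirr ε n)
    have hnorm := norm_cocycle_mulVec_le π ε n ((cocycle π ε n)⁻¹.mulVec v)
    rw [Matrix.mulVec_mulVec, Matrix.mul_nonsing_inv _ hu, Matrix.one_mulVec] at hnorm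
    rw [Nat.div_eq_of_lt hn, Nat.zero_sub, pow_zero, one_mul]
    refine hnorm.trans ?_
    gcongr
    exact one_le_two
  · obtain ⟨w, hw, rfl⟩ := hv
    have hw' : ∀ a, 0 ≤ w a := fun a => (hw a).le
    obtain ⟨b, hb⟩ := (hirr 0).exists_le_norm_Omega_mulVec
    have hu : ∀ a, 2 ^ (n / L - 1) * ∑ c, w c ≤ (cocycle π ε n).transpose.mulVec w a := by
      intro a
      rw [Finset.mul_sum]
      exact Finset.sum_le_sum fun c _ =>
        mul_le_mul_of_nonneg_right (two_pow_le_cocycle hL h hn c a) (hw' c)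
    have hsum : 0 ≤ ∑ c, w c := Finset.sum_nonneg fun c _ => hw' c
    change _ * ‖(π n).Omega.mulVec w‖ ≤ _ * ‖(cocycle π ε n)⁻¹.mulVec ((π n).Omega.mulVec w)‖
    rw [cocycle_inv_mulVec_Omega hirr hstep]
    calc (2 : ℝ) ^ (n / L - 1) * ‖(π n).Omega.mulVec w‖
        ≤ 2 ^ (n / L - 1) * ∑ c, w c := by
          gcongr
          exact norm_Omega_mulVec_le _ hw'
      _ ≤ (cocycle π ε n).transpose.mulVec w b := hu b
      _ ≤ ‖(π 0).Omega.mulVec ((cocycle π ε n).transpose.mulVec w)‖ :=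
          hb _ fun a => le_trans (by positivity) (hu a)
      _ ≤ _ := le_mul_of_one_le_left (norm_nonneg _) (one_le_pow₀ one_le_two)

end Cocycle

end CombData

/-- A norm on `ℝ^A` is equivalent to the sup norm. -/
theorem Seminorm.exists_equiv_pi_norm {A : Type*} [Fintype A] (N : Seminorm ℝ (A → ℝ))
    (hN : ∀ v, N v = 0 → v = 0) :
    ∃ c C : ℝ, 0 < c ∧ 0 < C ∧ ∀ v, c * ‖v‖ ≤ N v ∧ N v ≤ C * ‖v‖ := by
  classical
  obtain ⟨C, hC, hle⟩ : ∃ C : ℝ, 0 < C ∧ ∀ v, N v ≤ C * ‖v‖ := by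
    refine ⟨∑ a, N (Pi.single a 1) + 1, ?_, fun v => ?_⟩
    · have : 0 ≤ ∑ a, N (Pi.single a (1 : ℝ)) := Finset.sum_nonneg fun a _ => apply_nonneg N _
      linarith
    · calc N v = N (∑ a, v a • Pi.single a (1 : ℝ)) := by
            congr 1
            ext b
            simp [Finset.sum_apply, Pi.single_apply]
        _ ≤ ∑ a, N (v a • Pi.single a (1 : ℝ)) :=
            Finset.le_sum_of_subadditive N (map_zero N).le (map_add_le_add N) _ _
        _ ≤ ∑ a, N (Pi.single a (1 : ℝ)) * ‖v‖ := Finset.sum_le_sum fun a _ => by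
            rw [map_smul_eq_mul, mul_comm]
            exact mul_le_mul_of_nonneg_left (norm_le_pi_norm v a) (apply_nonneg N _)
        _ ≤ _ := by
            rw [← Finset.sum_mul, add_mul, one_mul]
            exact le_add_of_nonneg_right (norm_nonneg v)
  have hcont : Continuous N := (LipschitzWith.of_dist_le_mul (K := C.toNNReal) fun x y => by
    rw [Real.coe_toNNReal C hC.le, dist_eq_norm x y, Real.dist_eq]
    exact (abs_sub_map_le_sub N x y).trans (hle _)).continuous
  rcases isEmpty_or_nonempty A with hA | hA
  · exact ⟨1, C, one_pos, hC, fun v => ⟨by simp [Subsingleton.elim v 0], hle v⟩⟩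
  obtain ⟨x, hx, hmin⟩ := (isCompact_sphere (0 : A → ℝ) 1).exists_isMinOn
    (NormedSpace.sphere_nonempty.2 zero_le_one) hcont.continuousOn
  have hx1 : ‖x‖ = 1 := by simpa using hx
  refine ⟨N x, C, (apply_nonneg N x).lt_of_ne' fun h0 => ?_, hC, fun v => ⟨?_, hle v⟩⟩
  · rw [hN x h0, norm_zero] at hx1
    exact zero_ne_one hx1
  · rcases eq_or_ne v 0 with rfl | hv
    · simp
    · have hpos := norm_pos_iff.2 hv
      have := hmin (a := ‖v‖⁻¹ • v) (by simp [norm_smul, hpos.ne'])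
      rw [Set.mem_ofPred_eq, map_smul_eq_mul, norm_inv, norm_norm, le_inv_mul_iff₀ hpos] at this
      linarith

theorem mainTheorem6 (k : ℕ) :
    ∃ μ : ℝ, 1 < μ ∧
      ∀ (A : Type*) [Fintype A] [DecidableEq A] [Nontrivial A]
        (N : Seminorm ℝ (A → ℝ)), (∀ v, N v = 0 → v = 0) →
        ∃ C₁ C₂ : ℝ, 0 < C₁ ∧ 0 < C₂ ∧
          ∀ (π : ℕ → CombData A) (ε : ℕ → Fin 2),
            CombData.IsGenusOneCombinatorics π ε → CombData.IsBounded k π ε →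
            (∀ n : ℕ, ∀ v ∈ (π 0).coneU,
              C₁ * μ ^ n * N v ≤ N ((CombData.cocycle π ε (n + 1)).mulVec v)) ∧
            (∀ n : ℕ, ∀ v ∈ (π n).coneS,
              C₂ * μ ^ n * N v ≤ N ((CombData.cocycle π ε n)⁻¹.mulVec v)) := by
  obtain ⟨L, hLk⟩ : ∃ L, L = 2 * k + 1 := ⟨_, rfl⟩
  have hL : 0 < L := by omega
  obtain ⟨μ, hμ, hμL⟩ : ∃ μ : ℝ, 1 < μ ∧ μ ^ L = 2 := by
    refine ⟨2 ^ ((L : ℝ)⁻¹), Real.one_lt_rpow one_lt_two (by positivity), ?_⟩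
    exact Real.rpow_inv_natCast_pow zero_le_two hL.ne'
  have hpow : ∀ n, μ ^ n ≤ 4 * 2 ^ (n / L - 1) := by
    intro n
    calc μ ^ n ≤ μ ^ (L * (n / L - 1 + 2)) := by
          refine pow_le_pow_right₀ hμ.le ?_
          have h1 := Nat.lt_mul_div_succ n hL
          refine h1.le.trans (Nat.mul_le_mul_left L ?_)
          omega
      _ = 4 * 2 ^ (n / L - 1) := by rw [pow_mul, hμL, pow_add]; ring
  refine ⟨μ, hμ, ?_⟩
  intro A _ _ _ N hN
  obtain ⟨c, C, hc, hC, hNorm⟩ := N.exists_equiv_pi_norm hN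
  have hcompare : ∀ (D : ℝ) (n : ℕ) (v w : A → ℝ), 0 < D →
      2 ^ (n / L - 1) * ‖v‖ ≤ D * ‖w‖ → c / (4 * C * D) * μ ^ n * N v ≤ N w := by
    intro D n v w hD hvw
    have h1 : μ ^ n * N v ≤ 4 * C * D * ‖w‖ := by
      calc μ ^ n * N v ≤ (4 * 2 ^ (n / L - 1)) * (C * ‖v‖) :=
            mul_le_mul (hpow n) (hNorm v).2 (apply_nonneg N v) (by positivity)
        _ = 4 * C * (2 ^ (n / L - 1) * ‖v‖) := by ring
        _ ≤ 4 * C * (D * ‖w‖) := by gcongr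
        _ = _ := by ring
    calc c / (4 * C * D) * μ ^ n * N v = c / (4 * C * D) * (μ ^ n * N v) := by ring
      _ ≤ c / (4 * C * D) * (4 * C * D * ‖w‖) := by gcongr
      _ = c * ‖w‖ := by field_simp
      _ ≤ N w := (hNorm w).1
  refine ⟨c / (4 * C * 1), c / (4 * C * 2 ^ L), by positivity, by positivity, ?_⟩
  intro π ε hπ hb
  have hwin := hb.one_le_cocycle_window hπ.irreducible hπ.step
  rw [← hLk] at hwin
  refine ⟨fun n v hv => hcompare 1 n _ _ one_pos ?_, fun n v hv => hcompare _ n _ _ (by positivity)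
    (CombData.norm_le_norm_cocycle_inv_mulVec hL hπ.irreducible hπ.step hwin n hv)⟩
  rw [one_mul]
  refine le_trans ?_
    (CombData.norm_le_norm_cocycle_mulVec hL hwin (n + 1) (CombData.coneU_nonneg hv))
  gcongr
  · exact one_le_two
  · exact n.le_succ
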